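/- Let $u, v : [0,1] \to \mathbb{R}$ be continuous non-negative functions, each of which vanishes at some point of $[0,1]$ and neither of which is identically zero. Let $k_1, k_2 : [0,1]^2 \to \mathbb{C}$ be continuous with $k_i(x,s) = \overline{k_i(s,x)}$, and suppose that the integral operators $$(K_i\varphi)(x) = \int_0^1 k_i(x,s)\,\varphi(s)\,ds, \qquad \varphi \in L_2[0,1],\quad i = 1, 2,$$ are positive, i.e. $(K_i\varphi,\varphi) \ge 0$ for all $\varphi \in L_2[0,1]$. Let $T$ be the bounded self-adjoint operator in the complex Hilbert space $L_2([0,1]^2)$ (Lebesgue measure) given by $$(Tf)(x,y) = (u(x)+v(y))\,f(x,y) - \int_0^1 k_1(x,s)\,f(s,y)\,ds - \int_0^1 k_2(y,t)\,f(x,t)\,dt .$$ Then every isolated point of the spectrum $\sigma(T)$ is an eigenvalue of $T$ of finite multiplicity, i.e. its eigenspace is non-zero and finite-dimensional. -/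

import Mathlib

open MeasureTheory unitInterval
open scoped ENNReal

namespace FriedrichsModel

noncomputable section

/-- The complex Hilbert space `L₂` of a measure space. On the unit interval `I = [0,1]` and on the
square `I × I` the measure `volume` is Lebesgue measure. -/
abbrev L2 (Ω : Type) [MeasureSpace Ω] : Type := Lp ℂ 2 (volume : Measure Ω)

section PartialIntegral

variable {Ω Ω' : Type} [MeasureSpace Ω] [MeasureSpace Ω']

/-- Integrating out one variable of a square-integrable function gives a square-integrable
function, and does not increase the norm. -/
theorem eLpNorm_slice_integral_le {g : Ω × I → ℂ} (hg : AEStronglyMeasurable g volume) :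
    eLpNorm (fun p => ∫ s, g (p, s)) 2 (volume : Measure Ω) ≤ eLpNorm g 2 volume := by
  have key : ∀ᵐ p : Ω, ‖∫ s, g (p, s)‖ₑ ^ (2 : ℝ) ≤ ∫⁻ s, ‖g (p, s)‖ₑ ^ (2 : ℝ) := by
    filter_upwards [hg.prodMk_left] with p hp
    have h2 : eLpNorm (fun s => g (p, s)) 1 volume ≤ eLpNorm (fun s => g (p, s)) 2 volume :=
      eLpNorm_le_eLpNorm_of_exponent_le (by norm_num) hp
    rw [eLpNorm_one_eq_lintegral_enorm] at h2
    have h3 := eLpNorm_nnreal_pow_eq_lintegral (f := fun s => g (p, s)) (p := 2)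
      (μ := (volume : Measure I)) (by norm_num)
    have h4 := ENNReal.rpow_le_rpow ((enorm_integral_le_lintegral_enorm _).trans h2)
      (z := 2) (by norm_num)
    exact h4.trans_eq (by simpa using h3)
  have h1 := eLpNorm_nnreal_pow_eq_lintegral (f := fun p => ∫ s, g (p, s)) (p := 2)
      (μ := (volume : Measure Ω)) (by norm_num)
  have h2 := eLpNorm_nnreal_pow_eq_lintegral (f := g) (p := 2)
      (μ := (volume : Measure (Ω × I))) (by norm_num)
  have h3 : ∫⁻ z, ‖g z‖ₑ ^ (2 : ℝ) = ∫⁻ p : Ω, ∫⁻ s : I, ‖g (p, s)‖ₑ ^ (2 : ℝ) :=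
    lintegral_prod _ (hg.enorm.pow_const _)
  have h4 := lintegral_mono_ae key
  rw [← h3] at h4
  norm_num at h1 h2 h4
  rw [← h1, ← h2] at h4
  exact (ENNReal.pow_le_pow_left_iff (n := 2) (by norm_num)).1 h4

variable [TopologicalSpace Ω]

/-- The function `p ↦ ∫₀¹ k(p, s) f(φ(p, s)) ds`. -/
def partialIntegralFun (k : C(Ω × I, ℂ)) (φ : Ω × I → Ω') (f : Ω' → ℂ) (p : Ω) : ℂ :=
  ∫ s : I, k (p, s) * f (φ (p, s))

theorem aestronglyMeasurable_integrand [OpensMeasurableSpace Ω] (k : C(Ω × I, ℂ)) {φ : Ω × I → Ω'}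
    (hφ : MeasurePreserving φ) (f : L2 Ω') :
    AEStronglyMeasurable (fun z => k z * f (φ z)) volume :=
  k.continuous.aestronglyMeasurable.mul
    ((Lp.aestronglyMeasurable f).comp_measurePreserving hφ)

theorem eLpNorm_integrand_le [CompactSpace Ω] (k : C(Ω × I, ℂ)) {φ : Ω × I → Ω'}
    (hφ : MeasurePreserving φ) (f : L2 Ω') :
    eLpNorm (fun z => k z * f (φ z)) 2 volume ≤ ENNReal.ofReal ‖k‖ * eLpNorm f 2 volume := by
  have h := eLpNorm_comp_measurePreserving (p := 2) (Lp.aestronglyMeasurable f) hφ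
  rw [← h]
  refine eLpNorm_le_mul_eLpNorm_of_ae_le_mul (Filter.Eventually.of_forall fun z => ?_) 2
  rw [norm_mul]
  exact mul_le_mul_of_nonneg_right (k.norm_coe_le_norm z) (norm_nonneg _)

theorem eLpNorm_mul_le [CompactSpace Ω] (w : C(Ω, ℂ)) (f : L2 Ω) :
    eLpNorm (fun p => w p * f p) 2 volume ≤ ENNReal.ofReal ‖w‖ * eLpNorm f 2 volume := by
  refine eLpNorm_le_mul_eLpNorm_of_ae_le_mul (Filter.Eventually.of_forall fun p => ?_) 2
  rw [norm_mul]
  exact mul_le_mul_of_nonneg_right (w.norm_coe_le_norm p) (norm_nonneg _)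

variable [CompactSpace Ω] [OpensMeasurableSpace Ω]

theorem eLpNorm_partialIntegralFun_le (k : C(Ω × I, ℂ)) {φ : Ω × I → Ω'}
    (hφ : MeasurePreserving φ) (f : L2 Ω') :
    eLpNorm (partialIntegralFun k φ f) 2 volume ≤ ENNReal.ofReal ‖k‖ * eLpNorm f 2 volume :=
  (eLpNorm_slice_integral_le (aestronglyMeasurable_integrand k hφ f)).trans
    (eLpNorm_integrand_le k hφ f)

theorem memLp_partialIntegralFun (k : C(Ω × I, ℂ)) {φ : Ω × I → Ω'}
    (hφ : MeasurePreserving φ) (f : L2 Ω') : MemLp (partialIntegralFun k φ f) 2 volume :=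
  ⟨(aestronglyMeasurable_integrand k hφ f).integral_prod_right',
    (eLpNorm_partialIntegralFun_le k hφ f).trans_lt
      (ENNReal.mul_lt_top ENNReal.ofReal_lt_top (Lp.eLpNorm_lt_top f))⟩

theorem integrable_integrand [IsFiniteMeasure (volume : Measure Ω)] (k : C(Ω × I, ℂ)) {φ : Ω × I → Ω'}
    (hφ : MeasurePreserving φ) (f : L2 Ω') :
    ∀ᵐ p : Ω, Integrable (fun s : I => k (p, s) * f (φ (p, s))) :=
  Integrable.prod_right_ae (MemLp.integrable (q := 2) (by norm_num)
    ⟨aestronglyMeasurable_integrand k hφ f, (eLpNorm_integrand_le k hφ f).trans_lt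
      (ENNReal.mul_lt_top ENNReal.ofReal_lt_top (Lp.eLpNorm_lt_top f))⟩)

/-- The bounded operator `(A f)(p) = ∫₀¹ k(p, s) f(φ(p, s)) ds` from `L₂(Ω')` to `L₂(Ω)`, for a
continuous kernel `k` and a measure-preserving map `φ`. -/
def partialIntegralOp [IsFiniteMeasure (volume : Measure Ω)] (k : C(Ω × I, ℂ)) (φ : Ω × I → Ω') (hφ : MeasurePreserving φ) :
    L2 Ω' →L[ℂ] L2 Ω :=
  LinearMap.mkContinuous
    { toFun := fun f => (memLp_partialIntegralFun k hφ f).toLp (partialIntegralFun k φ f)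
      map_add' := fun f g => by
        rw [← MemLp.toLp_add]
        refine MemLp.toLp_congr _ _ ?_
        have h : ∀ᵐ z : Ω × I, (f + g : L2 Ω') (φ z) = f (φ z) + g (φ z) :=
          hφ.quasiMeasurePreserving.ae (Lp.coeFn_add f g)
        filter_upwards [Measure.ae_ae_of_ae_prod h, integrable_integrand k hφ f,
          integrable_integrand k hφ g] with p hp hf hg
        simp only [partialIntegralFun, Pi.add_apply]
        rw [← integral_add hf hg]
        refine integral_congr_ae ?_
        filter_upwards [hp] with s hs
        rw [hs, mul_add]
      map_smul' := fun c f => by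
        rw [RingHom.id_apply, ← MemLp.toLp_const_smul]
        refine MemLp.toLp_congr _ _ ?_
        have h : ∀ᵐ z : Ω × I, (c • f : L2 Ω') (φ z) = c * f (φ z) :=
          hφ.quasiMeasurePreserving.ae (Lp.coeFn_smul c f)
        filter_upwards [Measure.ae_ae_of_ae_prod h] with p hp
        simp only [partialIntegralFun, Pi.smul_apply, smul_eq_mul]
        rw [← integral_const_mul]
        refine integral_congr_ae ?_
        filter_upwards [hp] with s hs
        rw [hs]
        ring }
    ‖k‖ fun f => by
      change ‖(memLp_partialIntegralFun k hφ f).toLp _‖ ≤ _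
      rw [Lp.norm_toLp, Lp.norm_def, ← ENNReal.toReal_ofReal (norm_nonneg k),
        ← ENNReal.toReal_mul]
      exact ENNReal.toReal_mono
        (ENNReal.mul_lt_top ENNReal.ofReal_lt_top (Lp.eLpNorm_lt_top f)).ne
        (eLpNorm_partialIntegralFun_le k hφ f)

theorem memLp_mul (w : C(Ω, ℂ)) (f : L2 Ω) : MemLp (fun p => w p * f p) 2 volume :=
  ⟨w.continuous.aestronglyMeasurable.mul (Lp.aestronglyMeasurable f),
    (eLpNorm_mul_le w f).trans_lt
      (ENNReal.mul_lt_top ENNReal.ofReal_lt_top (Lp.eLpNorm_lt_top f))⟩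

/-- The bounded multiplication operator `(M f)(p) = w(p) f(p)` in `L₂(Ω)`, `w` continuous. -/
def mulOp (w : C(Ω, ℂ)) : L2 Ω →L[ℂ] L2 Ω :=
  LinearMap.mkContinuous
    { toFun := fun f => (memLp_mul w f).toLp (fun p => w p * f p)
      map_add' := fun f g => by
        rw [← MemLp.toLp_add]
        refine MemLp.toLp_congr _ _ ?_
        filter_upwards [Lp.coeFn_add f g] with p hp
        simp only [hp, Pi.add_apply, mul_add]
      map_smul' := fun c f => by
        rw [RingHom.id_apply, ← MemLp.toLp_const_smul]
        refine MemLp.toLp_congr _ _ ?_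
        filter_upwards [Lp.coeFn_smul c f] with p hp
        simp only [hp, Pi.smul_apply, smul_eq_mul]
        ring }
    ‖w‖ fun f => by
      change ‖(memLp_mul w f).toLp _‖ ≤ _
      rw [Lp.norm_toLp, Lp.norm_def, ← ENNReal.toReal_ofReal (norm_nonneg w),
        ← ENNReal.toReal_mul]
      exact ENNReal.toReal_mono
        (ENNReal.mul_lt_top ENNReal.ofReal_lt_top (Lp.eLpNorm_lt_top f)).ne
        (eLpNorm_mul_le w f)

end PartialIntegral

/-- The integral operator `(K φ)(x) = ∫₀¹ k(x, s) φ(s) ds` in `L₂[0,1]`. -/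
def integralOp (k : C(I × I, ℂ)) : L2 I →L[ℂ] L2 I :=
  partialIntegralOp k Prod.snd measurePreserving_snd

/-- The map `((x, y), s) ↦ (s, y)` preserves Lebesgue measure. -/
theorem measurePreserving_replaceFst :
    MeasurePreserving (fun z : (I × I) × I => (z.2, z.1.2)) := by
  have h : MeasurePreserving (Prod.map (Prod.snd : I × I → I) (id : I → I)) :=
    (measurePreserving_snd (μ := (volume : Measure I)) (ν := (volume : Measure I))).prod
      (MeasurePreserving.id volume)
  exact (Measure.measurePreserving_swap
    (μ := (volume : Measure I)) (ν := (volume : Measure I))).comp h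

/-- The map `((x, y), t) ↦ (x, t)` preserves Lebesgue measure. -/
theorem measurePreserving_replaceSnd :
    MeasurePreserving (fun z : (I × I) × I => (z.1.1, z.2)) :=
  (measurePreserving_fst (μ := (volume : Measure I)) (ν := (volume : Measure I))).prod
    (MeasurePreserving.id volume)

/-- `(T₀ f)(x, y) = (u(x) + v(y)) f(x, y)` in `L₂([0,1]²)`. -/
def T₀ (u v : C(I, ℝ)) : L2 (I × I) →L[ℂ] L2 (I × I) :=
  mulOp ⟨fun p => ((u p.1 + v p.2 : ℝ) : ℂ), by fun_prop⟩

/-- `(T₁ f)(x, y) = ∫₀¹∫₀¹ k₁(x, s) δ(y - t) f(s, t) ds dt = ∫₀¹ k₁(x, s) f(s, y) ds`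
in `L₂([0,1]²)`. -/
def T₁ (k₁ : C(I × I, ℂ)) : L2 (I × I) →L[ℂ] L2 (I × I) :=
  partialIntegralOp ⟨fun z => k₁ (z.1.1, z.2), by fun_prop⟩
    (fun z => (z.2, z.1.2)) measurePreserving_replaceFst

/-- `(T₂ f)(x, y) = ∫₀¹∫₀¹ k₂(y, t) δ(x - s) f(s, t) ds dt = ∫₀¹ k₂(y, t) f(x, t) dt`
in `L₂([0,1]²)`. -/
def T₂ (k₂ : C(I × I, ℂ)) : L2 (I × I) →L[ℂ] L2 (I × I) :=
  partialIntegralOp ⟨fun z => k₂ (z.1.2, z.2), by fun_prop⟩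
    (fun z => (z.1.1, z.2)) measurePreserving_replaceSnd

/-- The three-particle discrete Schrödinger operator `T = T₀ - (T₁ + T₂)`. -/
def schrodingerOp (u v : C(I, ℝ)) (k₁ k₂ : C(I × I, ℂ)) : L2 (I × I) →L[ℂ] L2 (I × I) :=
  T₀ u v - (T₁ k₁ + T₂ k₂)

end

end FriedrichsModel

/-! An isolated spectral point `z` of the self-adjoint operator `T` is an eigenvalue because the
indicator function of `{z}` is continuous on the spectrum: the functional calculus turns it into a
non-zero operator whose range consists of eigenvectors (`hasEigenvalue_of_isolated`).

For the multiplicity, put `S = T₀ - T₂ - z` and `S' = T₀ - T₁ - z`. Over the first variable `S`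
splits into the fibres `H + u(x) - z`, where `H` is the one-particle operator with potential `v` and
kernel `k₂`. If some fibre were singular, `z - u(x)` would lie in the spectrum of `H`, and a bump
function tensored with an approximate eigenvector of `H` would show that `u(y) + z - u(x)` lies in
the spectrum of `T` for every `y` (`add_mem_spectrum`). As `u` is continuous and non-constant on a
connected interval, `z` could not be isolated. A compactness argument makes the fibre bounds
uniform, so `S` is invertible (`isUnit_of_isolated`); interchanging the variables gives the same for
`S'`.

An eigenvector `f` satisfies `S f = T₁ f` and `S' f = T₂ f`, hence `f = S'⁻¹ T₂ S⁻¹ T₁ f`. The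
operator `T₂ S⁻¹ T₁` is compact (`isCompactOperator_T₂_comp_inverse_comp_T₁`): `T₁` is a norm limit
of sums of operators `f ↦ φ ⊗ X f`, left multiplication by `S`, and therefore by `S⁻¹`, preserves
the closed span of these, and `T₂` maps `φ ⊗ X f` to `φ ⊗ K₂ X f` with `K₂` compact. A compact
operator is thus the identity on the eigenspace, which must be finite-dimensional. -/

namespace FriedrichsModel

noncomputable section

/-! ### Operator theory in Hilbert space, and isolated points -/

section Abstract

variable {E F : Type*} [NormedAddCommGroup E] [InnerProductSpace ℂ E] [CompleteSpace E]
  [NormedAddCommGroup F] [NormedSpace ℂ F]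

/-- A self-adjoint operator that is bounded below is invertible. -/
theorem isUnit_of_isSelfAdjoint_of_bound {S : E →L[ℂ] E} (hS : IsSelfAdjoint S) {c : ℝ}
    (hc : 0 < c) (h : ∀ f, c * ‖f‖ ≤ ‖S f‖) : IsUnit S := by
  have hanti : AntilipschitzWith (Real.toNNReal c⁻¹) S := by
    refine ContinuousLinearMap.antilipschitz_of_bound S fun x => ?_
    rw [Real.coe_toNNReal _ (by positivity), ← div_eq_inv_mul, le_div_iff₀ hc, mul_comm]
    exact h x
  rw [ContinuousLinearMap.isUnit_iff_bijective]
  refine ⟨hanti.injective, ?_⟩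
  have hker : S.ker = ⊥ := LinearMap.ker_eq_bot.2 hanti.injective
  -- The closure of the range of the adjoint is the orthogonal complement of the kernel. Here the
  -- adjoint is `S`, the kernel is trivial and the lower bound makes the range closed.
  have h1 := ContinuousLinearMap.orthogonal_ker S
  rw [hker, Submodule.bot_orthogonal_eq_top, ← ContinuousLinearMap.star_eq_adjoint,
    hS.star_eq, IsClosed.submodule_topologicalClosure_eq] at h1
  · exact LinearMap.range_eq_top.1 h1.symm
  · exact hanti.isClosed_range S.uniformContinuous

/-- Weyl's criterion: singularity of a self-adjoint operator is witnessed by approximate null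
vectors. The strict inequality forces `f ≠ 0`. -/
theorem exists_norm_lt_of_not_isUnit {S : E →L[ℂ] E} (hS : IsSelfAdjoint S) (h : ¬ IsUnit S)
    {ε : ℝ} (hε : 0 < ε) : ∃ f, ‖S f‖ < ε * ‖f‖ := by
  by_contra! H
  exact h (isUnit_of_isSelfAdjoint_of_bound hS hε H)

/-- An isolated point of the spectrum of a self-adjoint operator is an eigenvalue. -/
theorem hasEigenvalue_of_isolated {S : E →L[ℂ] E} (hS : IsSelfAdjoint S) {z : ℂ}
    (hz : z ∈ spectrum ℂ S) (hiso : ∃ ε > 0, ∀ w ∈ spectrum ℂ S, dist w z < ε → w = z) :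
    Module.End.HasEigenvalue (S : E →ₗ[ℂ] E) z := by
  classical
  obtain ⟨ε, hε, hiso⟩ := hiso
  have hn : IsStarNormal S := hS.isStarNormal
  -- Isolation of `z` makes `χ` continuous on the spectrum. There `(w - z) χ(w) = 0`, so the range
  -- of `cfc χ S` lies in the eigenspace.
  let χ : ℂ → ℂ := fun w => if w = z then 1 else 0
  have hχ : ContinuousOn χ (spectrum ℂ S) := by
    intro w hw
    by_cases hwz : w = z
    · subst hwz
      have : χ =ᶠ[nhdsWithin w (spectrum ℂ S)] fun _ => 1 := by
        filter_upwards [self_mem_nhdsWithin,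
          mem_nhdsWithin_of_mem_nhds (Metric.ball_mem_nhds w hε)] with x hx hx'
        simp [χ, hiso x hx hx']
      exact (continuousWithinAt_const.congr_of_eventuallyEq this (by simp [χ]))
    · have : χ =ᶠ[nhdsWithin w (spectrum ℂ S)] fun _ => 0 := by
        filter_upwards [mem_nhdsWithin_of_mem_nhds (isOpen_ne.mem_nhds hwz)] with x hx
        simp only [χ]
        exact if_neg hx
      exact (continuousWithinAt_const.congr_of_eventuallyEq this (by simp [χ, hwz]))
  have hprod : (S - algebraMap ℂ _ z) * cfc χ S = 0 := by
    have h1 : S - algebraMap ℂ _ z = cfc (fun w => w - z) S := by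
      rw [cfc_sub (fun w => w) (fun _ => z) S, cfc_id' ℂ S, cfc_const z S]
    rw [h1, ← cfc_mul _ _ S (by fun_prop) hχ, ← cfc_zero ℂ S]
    refine cfc_congr fun w _ => ?_
    by_cases hwz : w = z <;> simp [χ, hwz]
  have hne : cfc χ S ≠ 0 := by
    intro h0
    have h2 : (1 : ℂ) ∈ spectrum ℂ (cfc χ S) := by
      rw [cfc_map_spectrum χ S]
      exact ⟨z, hz, by simp [χ]⟩
    rw [h0] at h2
    have : Nontrivial (E →L[ℂ] E) := by
      by_contra hnt
      rw [not_nontrivial_iff_subsingleton] at hnt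
      simp [spectrum.of_subsingleton] at hz
    rw [spectrum.zero_eq] at h2
    simp at h2
  obtain ⟨f, hf⟩ : ∃ f, cfc χ S f ≠ 0 := by
    by_contra! H
    exact hne (ContinuousLinearMap.ext H)
  refine Module.End.hasEigenvalue_of_hasEigenvector (x := cfc χ S f) ⟨?_, hf⟩
  rw [Module.End.mem_eigenspace_iff]
  have h3 : S (cfc χ S f) - z • cfc χ S f = 0 := by
    have := congrArg (fun A : E →L[ℂ] E => A f) hprod
    rwa [Algebra.algebraMap_eq_smul_one] at this
  exact sub_eq_zero.1 h3

/-- A closed space of operators that is invariant under left multiplication by an invertible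
self-adjoint operator is invariant under left multiplication by its inverse. -/
theorem comp_mem_of_inverse {S R : E →L[ℂ] E} (hS : IsSelfAdjoint S) (hSR : S * R = 1)
    (hRS : R * S = 1) {W : Submodule ℂ (F →L[ℂ] E)}
    (hW : IsClosed (W : Set (F →L[ℂ] E))) (hSW : ∀ w ∈ W, S ∘L w ∈ W) :
    ∀ w ∈ W, R ∘L w ∈ W := by
  have hn : IsStarNormal S := hS.isStarNormal
  have h0 : (0 : ℂ) ∉ spectrum ℂ S := by
    rw [spectrum.zero_notMem_iff]
    exact ⟨⟨S, R, hSR, hRS⟩, rfl⟩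
  have hR : R = cfc (fun w : ℂ => w⁻¹) S := by
    have h1 := cfc_inv_id (⟨S, R, hSR, hRS⟩ : (E →L[ℂ] E)ˣ) (R := ℂ) (p := IsStarNormal)
    exact h1.symm
  have hmem : R ∈ StarAlgebra.elemental ℂ S := by
    rw [hR]
    exact cfc_mem_elemental _ _
  -- The inverse lies in the closed star algebra generated by `S`. Requiring invariance of `W` under
  -- both `A` and `star A` makes `B` a star subalgebra; it contains `S` because `S` is self-adjoint.
  let B : StarSubalgebra ℂ (E →L[ℂ] E) :=
    { carrier := {A | (∀ w ∈ W, A ∘L w ∈ W) ∧ (∀ w ∈ W, star A ∘L w ∈ W)}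
      mul_mem' := fun {A A'} hA hA' =>
        ⟨fun w hw => by
          rw [ContinuousLinearMap.mul_def, ContinuousLinearMap.comp_assoc]
          exact hA.1 _ (hA'.1 w hw), fun w hw => by
          rw [star_mul, ContinuousLinearMap.mul_def, ContinuousLinearMap.comp_assoc]
          exact hA'.2 _ (hA.2 w hw)⟩
      add_mem' := fun {A A'} hA hA' =>
        ⟨fun w hw => by
          rw [ContinuousLinearMap.add_comp]
          exact W.add_mem (hA.1 w hw) (hA'.1 w hw), fun w hw => by
          rw [star_add, ContinuousLinearMap.add_comp]
          exact W.add_mem (hA.2 w hw) (hA'.2 w hw)⟩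
      algebraMap_mem' := fun r => by
        have key : ∀ r : ℂ, ∀ w ∈ W, (algebraMap ℂ (E →L[ℂ] E) r) ∘L w ∈ W := fun r w hw => by
          have : (algebraMap ℂ (E →L[ℂ] E) r) ∘L w = r • w := by
            ext x
            simp [Algebra.algebraMap_eq_smul_one]
          rw [this]
          exact W.smul_mem r hw
        refine ⟨key r, ?_⟩
        rw [← algebraMap_star_comm]
        exact key _
      star_mem' := fun {A} hA => ⟨hA.2, by simpa using hA.1⟩ }
  have hB : IsClosed (B : Set (E →L[ℂ] E)) := by
    have hcl : IsClosed {A : E →L[ℂ] E | ∀ w ∈ W, A ∘L w ∈ W} := by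
      simp only [Set.ofPred_forall]
      refine isClosed_iInter fun w => isClosed_iInter fun _ => hW.preimage ?_
      exact ((ContinuousLinearMap.compL ℂ F E E).flip w).continuous
    exact hcl.inter (hcl.preimage continuous_star)
  have hle : StarAlgebra.elemental ℂ S ≤ B :=
    StarAlgebra.elemental.le_of_mem hB ⟨hSW, by rw [hS.star_eq]; exact hSW⟩
  exact (hle hmem).1

/-- A closed subspace on which a compact operator acts as the identity is finite-dimensional. -/
theorem finiteDimensional_of_compact_eq_self {C : F →L[ℂ] F} (hC : IsCompactOperator C)
    {V : Submodule ℂ F} (hV : IsClosed (V : Set F)) (h : ∀ f ∈ V, C f = f) :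
    FiniteDimensional ℂ V := by
  refine FiniteDimensional.of_isCompactOperator_id (𝕜 := ℂ) ?_
  have h1 := (hC.comp_clm V.subtypeL).codRestrict (V := V)
    (fun x => by simp [h x x.2]) hV
  have h2 : (id : V → V) = Set.codRestrict (C ∘ V.subtypeL) V (fun x => by simp [h x x.2]) :=
    funext fun x => Subtype.ext (h x x.2).symm
  rw [h2]
  exact h1

/-- A continuous family of invertible operators on a compact space is uniformly bounded below. -/
theorem exists_bound_of_isUnit {X : Type*} [TopologicalSpace X] [CompactSpace X]
    {S : X → E →L[ℂ] E} (hS : Continuous S) (h : ∀ x, IsUnit (S x)) :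
    ∃ c > 0, ∀ x f, c * ‖f‖ ≤ ‖S x f‖ := by
  -- Inversion is continuous at units, so the inverses have bounded norm on the compact space.
  have hcont : Continuous fun x => Ring.inverse (S x) := by
    rw [continuous_iff_continuousAt]
    intro x
    obtain ⟨a, ha⟩ := h x
    have := NormedRing.inverse_continuousAt a
    rw [ha] at this
    exact ContinuousAt.comp (f := S) (x := x) this hS.continuousAt
  obtain ⟨M, hM⟩ := (isCompact_range hcont).isBounded.exists_norm_le
  have hM' : 0 < |M| + 1 := by positivity
  refine ⟨(|M| + 1)⁻¹, by positivity, fun x f => ?_⟩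
  rw [← div_eq_inv_mul, div_le_iff₀ hM']
  have h1 : Ring.inverse (S x) (S x f) = f := by
    have := congrArg (fun A : E →L[ℂ] E => A f) (Ring.inverse_mul_cancel _ (h x))
    exact this
  calc ‖f‖ = ‖Ring.inverse (S x) (S x f)‖ := by rw [h1]
    _ ≤ ‖Ring.inverse (S x)‖ * ‖S x f‖ := ContinuousLinearMap.le_opNorm _ _
    _ ≤ (|M| + 1) * ‖S x f‖ := by
        gcongr
        exact (hM _ ⟨x, rfl⟩).trans ((le_abs_self M).trans (by linarith))
    _ = ‖S x f‖ * (|M| + 1) := mul_comm _ _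

/-- No value of a non-constant continuous function with values in `s` is isolated in `s`, on a
connected space. -/
theorem not_isolated_of_forall_mem {X : Type*} [TopologicalSpace X] [PreconnectedSpace X]
    {s : Set ℂ} {v : X → ℂ} (hv : Continuous v) (hs : ∀ x, v x ∈ s) {x₀ x₁ : X}
    (hne : v x₁ ≠ v x₀) {y : X} :
    ¬ ∃ ε > 0, ∀ w ∈ s, dist w (v y) < ε → w = v y := by
  rintro ⟨ε, hε, h⟩
  -- Isolation makes this level set open as well as closed; by connectedness `v` would be constant.
  have hclopen : IsClopen {x | v x = v y} := by
    refine ⟨isClosed_eq hv continuous_const, ?_⟩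
    have : {x | v x = v y} = {x | dist (v x) (v y) < ε} := by
      ext x
      refine ⟨fun hx => ?_, fun hx => h _ (hs x) hx⟩
      have hx' : v x = v y := hx
      have : dist (v x) (v y) < ε := by rwa [hx', dist_self]
      exact this
    rw [this]
    exact isOpen_lt (hv.dist continuous_const) continuous_const
  have huniv := hclopen.eq_univ ⟨y, rfl⟩
  have h0 : x₀ ∈ {x | v x = v y} := huniv ▸ Set.mem_univ _
  have h1 : x₁ ∈ {x | v x = v y} := huniv ▸ Set.mem_univ _
  exact hne (h1.trans h0.symm)

end Abstract

/-! ### Partial integral operators: dependence on the kernel and self-adjointness -/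

section General

variable {Ω Ω' : Type} [MeasureSpace Ω] [MeasureSpace Ω'] [TopologicalSpace Ω] [CompactSpace Ω]
  [OpensMeasurableSpace Ω]

theorem coeFn_mulOp (w : C(Ω, ℂ)) (f : L2 Ω) : mulOp w f =ᵐ[volume] fun p => w p * f p :=
  MemLp.coeFn_toLp (memLp_mul w f)

theorem isSelfAdjoint_mulOp {w : C(Ω, ℂ)} (hw : ∀ p, star (w p) = w p) :
    IsSelfAdjoint (mulOp w) := by
  rw [ContinuousLinearMap.isSelfAdjoint_iff_isSymmetric]
  intro f g
  rw [L2.inner_def, L2.inner_def]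
  refine integral_congr_ae ?_
  filter_upwards [coeFn_mulOp w f, coeFn_mulOp w g] with p h1 h2
  have h3 : (starRingEnd ℂ) (w p) = w p := hw p
  simp only [ContinuousLinearMap.coe_coe, h1, h2, RCLike.inner_apply, map_mul, h3]
  ring

variable [IsFiniteMeasure (volume : Measure Ω)]

theorem coeFn_partialIntegralOp (k : C(Ω × I, ℂ)) {φ : Ω × I → Ω'} (hφ : MeasurePreserving φ)
    (f : L2 Ω') :
    partialIntegralOp k φ hφ f =ᵐ[volume] fun p => ∫ s : I, k (p, s) * f (φ (p, s)) :=
  MemLp.coeFn_toLp (memLp_partialIntegralFun k hφ f)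

theorem norm_partialIntegralOp_le (k : C(Ω × I, ℂ)) {φ : Ω × I → Ω'} (hφ : MeasurePreserving φ) :
    ‖partialIntegralOp k φ hφ‖ ≤ ‖k‖ := by
  unfold partialIntegralOp
  apply LinearMap.mkContinuous_norm_le
  exact norm_nonneg k

/-- `partialIntegralOp` as a bounded linear function of the kernel. -/
def partialIntegralL {φ : Ω × I → Ω'} (hφ : MeasurePreserving φ) :
    C(Ω × I, ℂ) →L[ℂ] (L2 Ω' →L[ℂ] L2 Ω) :=
  LinearMap.mkContinuous
    { toFun := fun k => partialIntegralOp k φ hφ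
      map_add' := fun k k' => by
        ext1 f
        refine Lp.ext ?_
        change _ =ᵐ[volume] ↑(partialIntegralOp k φ hφ f + partialIntegralOp k' φ hφ f)
        filter_upwards [coeFn_partialIntegralOp (k + k') hφ f, coeFn_partialIntegralOp k hφ f,
          coeFn_partialIntegralOp k' hφ f, integrable_integrand k hφ f,
          integrable_integrand k' hφ f,
          Lp.coeFn_add (partialIntegralOp k φ hφ f) (partialIntegralOp k' φ hφ f)]
          with p h1 h2 h3 h4 h5 h6
        rw [h1, h6, Pi.add_apply, h2, h3, ← integral_add h4 h5]
        simp only [ContinuousMap.add_apply, add_mul]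
      map_smul' := fun c k => by
        ext1 f
        refine Lp.ext ?_
        change _ =ᵐ[volume] ↑(c • partialIntegralOp k φ hφ f)
        filter_upwards [coeFn_partialIntegralOp (c • k) hφ f, coeFn_partialIntegralOp k hφ f,
          Lp.coeFn_smul c (partialIntegralOp k φ hφ f)] with p h1 h2 h3
        rw [h1, h3, Pi.smul_apply, h2, smul_eq_mul, ← integral_const_mul]
        simp only [ContinuousMap.smul_apply, smul_eq_mul, mul_assoc] }
    1 fun k => by
      rw [one_mul]
      exact norm_partialIntegralOp_le k hφ

/-- A partial integral operator with Hermitian kernel is self-adjoint. The symmetry is expressed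
by a measure-preserving involution `τ` that interchanges the two arguments. -/
theorem isSelfAdjoint_partialIntegralOp [SigmaFinite (volume : Measure Ω)] {k : C(Ω × I, ℂ)}
    {φ : Ω × I → Ω} (hφ : MeasurePreserving φ)
    {τ : Ω × I → Ω × I} (hτ : MeasurePreserving τ) (hτφ : ∀ z, (τ z).1 = φ z)
    (hφτ : ∀ z, φ (τ z) = z.1) (hk : ∀ z, k (τ z) = star (k z)) :
    IsSelfAdjoint (partialIntegralOp k φ hφ) := by
  have hint : ∀ f g : L2 Ω,
      Integrable (fun z : Ω × I => inner ℂ (f z.1) (k z * g (φ z))) volume := by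
    intro f g
    have h1 : MemLp (fun z : Ω × I => f z.1) 2 volume :=
      (Lp.memLp f).comp_measurePreserving measurePreserving_fst
    have h2 : MemLp (fun z => k z * g (φ z)) 2 volume :=
      ⟨aestronglyMeasurable_integrand k hφ g, (eLpNorm_integrand_le k hφ g).trans_lt
        (ENNReal.mul_lt_top ENNReal.ofReal_lt_top (Lp.eLpNorm_lt_top g))⟩
    exact h2.integrable_mul h1.star
  have key : ∀ f g : L2 Ω, inner ℂ f (partialIntegralOp k φ hφ g) =
      ∫ z : Ω × I, inner ℂ (f z.1) (k z * g (φ z)) := by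
    intro f g
    rw [L2.inner_def]
    refine Eq.trans ?_ (integral_prod _ (hint f g)).symm
    refine integral_congr_ae ?_
    filter_upwards [coeFn_partialIntegralOp k hφ g, integrable_integrand k hφ g] with p h1 h2
    rw [h1]
    exact (integral_inner h2 (f p)).symm
  rw [ContinuousLinearMap.isSelfAdjoint_iff_isSymmetric]
  intro f g
  change inner ℂ (partialIntegralOp k φ hφ f) g = inner ℂ f (partialIntegralOp k φ hφ g)
  rw [← inner_conj_symm, key, key, ← integral_conj]
  -- Both inner products are integrals over `Ω × I`; the substitution `τ` carries one into the
  -- other.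
  have hmap := integral_map (μ := volume) hτ.measurable.aemeasurable
    (f := fun z => inner ℂ (f z.1) (k z * g (φ z)))
    (by rw [hτ.map_eq]; exact (hint f g).aestronglyMeasurable)
  rw [hτ.map_eq] at hmap
  rw [hmap]
  refine integral_congr_ae (Filter.Eventually.of_forall fun z => ?_)
  simp only [hτφ, hφτ, hk, RCLike.inner_apply, map_mul, RCLike.conj_conj, RCLike.star_def]
  ring

end General

/-! ### The operators on the square and the interchange of variables -/

section Square

/-- The map `((x, y), t) ↦ ((x, t), y)` preserves Lebesgue measure. -/
theorem measurePreserving_exchangeSnd :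
    MeasurePreserving (fun z : (I × I) × I => ((z.1.1, z.2), z.1.2)) := by
  have h1 := measurePreserving_prodAssoc (volume : Measure I) (volume : Measure I)
    (volume : Measure I)
  have h2 : MeasurePreserving (Prod.map id Prod.swap : I × (I × I) → I × (I × I)) :=
    (MeasurePreserving.id volume).prod Measure.measurePreserving_swap
  exact (h1.symm _).comp (h2.comp h1)

/-- The map `((x, y), s) ↦ ((s, y), x)` preserves Lebesgue measure. -/
theorem measurePreserving_exchangeFst :
    MeasurePreserving (fun z : (I × I) × I => ((z.2, z.1.2), z.1.1)) := by
  have h1 : MeasurePreserving (Prod.map Prod.swap id : (I × I) × I → (I × I) × I) :=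
    (Measure.measurePreserving_swap (μ := (volume : Measure I)) (ν := (volume : Measure I))).prod
      (MeasurePreserving.id volume)
  exact h1.comp (measurePreserving_exchangeSnd.comp h1)

theorem coeFn_T₀ (u v : C(I, ℝ)) (f : L2 (I × I)) :
    T₀ u v f =ᵐ[volume] fun p => ((u p.1 + v p.2 : ℝ) : ℂ) * f p :=
  coeFn_mulOp _ f

theorem coeFn_T₁ (k : C(I × I, ℂ)) (f : L2 (I × I)) :
    T₁ k f =ᵐ[volume] fun p => ∫ s, k (p.1, s) * f (s, p.2) :=
  coeFn_partialIntegralOp _ _ f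

theorem coeFn_T₂ (k : C(I × I, ℂ)) (f : L2 (I × I)) :
    T₂ k f =ᵐ[volume] fun p => ∫ t, k (p.2, t) * f (p.1, t) :=
  coeFn_partialIntegralOp _ _ f

theorem coeFn_integralOp (k : C(I × I, ℂ)) (f : L2 I) :
    integralOp k f =ᵐ[volume] fun x => ∫ s, k (x, s) * f s :=
  coeFn_partialIntegralOp _ _ f

theorem isSelfAdjoint_T₀ (u v : C(I, ℝ)) : IsSelfAdjoint (T₀ u v) :=
  isSelfAdjoint_mulOp fun _ => Complex.conj_ofReal _

theorem isSelfAdjoint_T₁ {k : C(I × I, ℂ)} (hk : ∀ x s, k (x, s) = star (k (s, x))) :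
    IsSelfAdjoint (T₁ k) :=
  isSelfAdjoint_partialIntegralOp _ measurePreserving_exchangeFst (fun _ => rfl) (fun _ => rfl)
    fun _ => hk _ _

theorem isSelfAdjoint_T₂ {k : C(I × I, ℂ)} (hk : ∀ x s, k (x, s) = star (k (s, x))) :
    IsSelfAdjoint (T₂ k) :=
  isSelfAdjoint_partialIntegralOp _ measurePreserving_exchangeSnd (fun _ => rfl) (fun _ => rfl)
    fun _ => hk _ _

theorem isSelfAdjoint_integralOp {k : C(I × I, ℂ)} (hk : ∀ x s, k (x, s) = star (k (s, x))) :
    IsSelfAdjoint (integralOp k) :=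
  isSelfAdjoint_partialIntegralOp _ Measure.measurePreserving_swap (fun _ => rfl) (fun _ => rfl)
    fun _ => hk _ _

theorem isSelfAdjoint_schrodingerOp (u v : C(I, ℝ)) {k₁ k₂ : C(I × I, ℂ)}
    (hk₁ : ∀ x s, k₁ (x, s) = star (k₁ (s, x))) (hk₂ : ∀ x s, k₂ (x, s) = star (k₂ (s, x))) :
    IsSelfAdjoint (schrodingerOp u v k₁ k₂) :=
  (isSelfAdjoint_T₀ u v).sub ((isSelfAdjoint_T₁ hk₁).add (isSelfAdjoint_T₂ hk₂))

/-- The one-particle operator `(H φ)(y) = v(y) φ(y) - ∫₀¹ k(y, t) φ(t) dt` in `L₂[0,1]`. -/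
def friedrichsOp (v : C(I, ℝ)) (k : C(I × I, ℂ)) : L2 I →L[ℂ] L2 I :=
  mulOp ⟨fun y => (v y : ℂ), by fun_prop⟩ - integralOp k

theorem isSelfAdjoint_friedrichsOp (v : C(I, ℝ)) {k : C(I × I, ℂ)}
    (hk : ∀ x s, k (x, s) = star (k (s, x))) : IsSelfAdjoint (friedrichsOp v k) :=
  (isSelfAdjoint_mulOp fun _ => Complex.conj_ofReal _).sub (isSelfAdjoint_integralOp hk)

theorem coeFn_friedrichsOp (v : C(I, ℝ)) (k : C(I × I, ℂ)) (f : L2 I) :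
    friedrichsOp v k f =ᵐ[volume] fun y => v y * f y - ∫ t, k (y, t) * f t := by
  filter_upwards [coeFn_mulOp (⟨fun y => (v y : ℂ), by fun_prop⟩ : C(I, ℂ)) f,
    coeFn_integralOp k f, Lp.coeFn_sub (mulOp (⟨fun y => (v y : ℂ), by fun_prop⟩ : C(I, ℂ)) f)
    (integralOp k f)] with y h1 h2 h3
  change (mulOp (⟨fun y => (v y : ℂ), by fun_prop⟩ : C(I, ℂ)) f - integralOp k f) y = _
  rw [h3, Pi.sub_apply, h1, h2]
  rfl

/-- The interchange of the two variables, as an operator in `L₂([0,1]²)`. -/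
def swapOp : L2 (I × I) →L[ℂ] L2 (I × I) :=
  (Lp.compMeasurePreservingₗᵢ ℂ (Prod.swap : I × I → I × I)
    Measure.measurePreserving_swap).toContinuousLinearMap

theorem coeFn_swapOp (f : L2 (I × I)) : swapOp f =ᵐ[volume] fun p => f p.swap :=
  Lp.coeFn_compMeasurePreserving f Measure.measurePreserving_swap

theorem ae_swap {P : I × I → Prop} (h : ∀ᵐ p, P p) : ∀ᵐ p : I × I, P p.swap :=
  (Measure.measurePreserving_swap (μ := (volume : Measure I))
    (ν := (volume : Measure I))).quasiMeasurePreserving.ae h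

theorem swapOp_mul_swapOp : swapOp * swapOp = 1 := by
  ext1 f
  refine Lp.ext ?_
  change swapOp (swapOp f) =ᵐ[volume] f
  filter_upwards [coeFn_swapOp (swapOp f), ae_swap (coeFn_swapOp f)] with p h1 h2
  rw [h1, h2, Prod.swap_swap]

theorem swapOp_T₀ (u v : C(I, ℝ)) : swapOp * T₀ u v = T₀ v u * swapOp := by
  ext1 f
  refine Lp.ext ?_
  change swapOp (T₀ u v f) =ᵐ[volume] T₀ v u (swapOp f)
  filter_upwards [coeFn_swapOp (T₀ u v f), coeFn_swapOp f, ae_swap (coeFn_T₀ u v f),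
    coeFn_T₀ v u (swapOp f)] with p h1 h2 h3 h4
  rw [h1, h3, h4, h2]
  simp [add_comm]

theorem swapOp_T₁ (k : C(I × I, ℂ)) : swapOp * T₁ k = T₂ k * swapOp := by
  ext1 f
  refine Lp.ext ?_
  change swapOp (T₁ k f) =ᵐ[volume] T₂ k (swapOp f)
  filter_upwards [coeFn_swapOp (T₁ k f), ae_swap (coeFn_T₁ k f), coeFn_T₂ k (swapOp f),
    Measure.ae_ae_of_ae_prod (measurePreserving_replaceSnd.quasiMeasurePreserving.ae
      (coeFn_swapOp f))] with p h1 h2 h3 h4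
  rw [h1, h2, h3]
  refine integral_congr_ae ?_
  filter_upwards [h4] with t ht
  rw [ht]
  rfl

theorem swapOp_T₂ (k : C(I × I, ℂ)) : swapOp * T₂ k = T₁ k * swapOp := by
  -- Multiplying `swapOp_T₁` by the involution on both sides exchanges the roles of `T₁` and `T₂`.
  have h := congrArg (fun A => swapOp * A * swapOp) (swapOp_T₁ k)
  rw [← mul_assoc, swapOp_mul_swapOp, one_mul, mul_assoc, mul_assoc, swapOp_mul_swapOp,
    mul_one] at h
  exact h.symm

theorem swapOp_schrodingerOp (u v : C(I, ℝ)) (k₁ k₂ : C(I × I, ℂ)) :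
    swapOp * schrodingerOp u v k₁ k₂ = schrodingerOp v u k₂ k₁ * swapOp := by
  rw [schrodingerOp, schrodingerOp, mul_sub, mul_add, swapOp_T₀, swapOp_T₁, swapOp_T₂, sub_mul,
    add_mul, add_comm (T₂ k₁ * swapOp)]

/-- The interchange of the two variables, as a unit of the algebra of bounded operators. -/
def swapUnit : (L2 (I × I) →L[ℂ] L2 (I × I))ˣ :=
  ⟨swapOp, swapOp, swapOp_mul_swapOp, swapOp_mul_swapOp⟩

theorem spectrum_schrodingerOp_swap (u v : C(I, ℝ)) (k₁ k₂ : C(I × I, ℂ)) :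
    spectrum ℂ (schrodingerOp v u k₂ k₁) = spectrum ℂ (schrodingerOp u v k₁ k₂) := by
  have h : schrodingerOp v u k₂ k₁ = swapUnit * schrodingerOp u v k₁ k₂ * (swapUnit⁻¹ :) := by
    change _ = swapOp * _ * swapOp
    rw [swapOp_schrodingerOp, mul_assoc, swapOp_mul_swapOp, mul_one]
  rw [h, spectrum.units_conjugate]

end Square

/-! ### Separable kernels and compactness of `T₂ S⁻¹ T₁` -/

section Compactness

/-- The kernel `(x, s) ↦ φ(x) ψ(s)`. -/
def sepKernel (φ ψ : C(I, ℂ)) : C(I × I, ℂ) := ⟨fun p => φ p.1 * ψ p.2, by fun_prop⟩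

/-- Stone–Weierstrass: separable kernels are closed under products and conjugation, and the two
coordinate functions already separate points. -/
theorem span_sepKernel_topologicalClosure :
    (Submodule.span ℂ {k | ∃ φ ψ, k = sepKernel φ ψ}).topologicalClosure = ⊤ := by
  set P : Set C(I × I, ℂ) := {k | ∃ φ ψ, k = sepKernel φ ψ} with hP
  have hmul : ∀ a ∈ Submodule.span ℂ P, ∀ b ∈ Submodule.span ℂ P,
      a * b ∈ Submodule.span ℂ P := by
    intro a ha b hb
    have h := Submodule.mul_mem_mul ha hb
    rw [Submodule.span_mul_span] at h
    refine Submodule.span_mono ?_ h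
    rintro _ ⟨_, ⟨φ, ψ, rfl⟩, _, ⟨φ', ψ', rfl⟩, rfl⟩
    refine ⟨φ * φ', ψ * ψ', ?_⟩
    ext p
    simp only [sepKernel, ContinuousMap.mul_apply, ContinuousMap.coe_mk]
    ring
  let A : StarSubalgebra ℂ C(I × I, ℂ) :=
    { carrier := Submodule.span ℂ P
      mul_mem' := fun {a b} ha hb => hmul a ha b hb
      add_mem' := fun ha hb => Submodule.add_mem _ ha hb
      algebraMap_mem' := fun r => by
        rw [Algebra.algebraMap_eq_smul_one]
        refine Submodule.smul_mem _ _ (Submodule.subset_span ⟨1, 1, ?_⟩)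
        ext p
        simp [sepKernel]
      star_mem' := fun {a} ha => by
        induction ha using Submodule.span_induction with
        | mem x hx =>
          obtain ⟨φ, ψ, rfl⟩ := hx
          refine Submodule.subset_span ⟨star φ, star ψ, ?_⟩
          ext p
          simp [sepKernel]
        | zero => simp
        | add x y _ _ hx hy =>
          rw [star_add]
          exact Submodule.add_mem _ hx hy
        | smul c x _ hx =>
          rw [star_smul]
          exact Submodule.smul_mem _ _ hx }
  have hsep : A.SeparatesPoints := by
    intro p q hpq
    by_cases h : p.1 = q.1
    · refine ⟨sepKernel 1 ⟨fun y => ((y : ℝ) : ℂ), by fun_prop⟩,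
        ⟨_, Submodule.subset_span ⟨_, _, rfl⟩, rfl⟩, ?_⟩
      have h2 : p.2 ≠ q.2 := fun h2 => hpq (Prod.ext h h2)
      simpa [sepKernel, Subtype.ext_iff] using h2
    · refine ⟨sepKernel ⟨fun y => ((y : ℝ) : ℂ), by fun_prop⟩ 1,
        ⟨_, Submodule.subset_span ⟨_, _, rfl⟩, rfl⟩, ?_⟩
      simpa [sepKernel, Subtype.ext_iff] using h
  have h := ContinuousMap.starSubalgebra_topologicalClosure_eq_top_of_separatesPoints A hsep
  rw [Submodule.eq_top_iff']
  intro k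
  have hk : k ∈ A.topologicalClosure := h ▸ StarSubalgebra.mem_top
  exact hk

/-- A continuous linear map on kernels takes values in a closed subspace as soon as it does so on
separable kernels. -/
theorem map_mem_of_forall_sepKernel {E : Type*} [NormedAddCommGroup E] [NormedSpace ℂ E]
    (Φ : C(I × I, ℂ) →L[ℂ] E) {W : Submodule ℂ E} (hW : IsClosed (W : Set E))
    (h : ∀ φ ψ, Φ (sepKernel φ ψ) ∈ W) (k : C(I × I, ℂ)) : Φ k ∈ W := by
  have hle : (Submodule.span ℂ {k | ∃ φ ψ, k = sepKernel φ ψ}).topologicalClosure ≤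
      W.comap (Φ : C(I × I, ℂ) →ₗ[ℂ] E) := by
    refine Submodule.topologicalClosure_minimal _ (Submodule.span_le.2 ?_)
      (hW.preimage Φ.continuous)
    rintro _ ⟨φ, ψ, rfl⟩
    exact h φ ψ
  rw [span_sepKernel_topologicalClosure] at hle
  exact hle (Submodule.mem_top (x := k))

theorem integralOp_sepKernel (φ ψ : C(I, ℂ)) :
    integralOp (sepKernel φ ψ) = (innerSL ℂ (ContinuousMap.toLp 2 volume ℂ (star ψ))).smulRight
      (ContinuousMap.toLp 2 volume ℂ φ) := by
  ext1 f
  refine Lp.ext ?_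
  set Φ : L2 I := ContinuousMap.toLp 2 volume ℂ φ with hΦ
  set Ψ : L2 I := ContinuousMap.toLp 2 volume ℂ (star ψ) with hΨ
  change _ =ᵐ[volume] ↑((inner ℂ Ψ f : ℂ) • Φ)
  filter_upwards [coeFn_integralOp (sepKernel φ ψ) f, Lp.coeFn_smul (inner ℂ Ψ f : ℂ) Φ,
    ContinuousMap.coeFn_toLp (p := 2) (𝕜 := ℂ) volume φ] with x h1 h2 h3
  rw [h1, h2, Pi.smul_apply, hΦ, h3, L2.inner_def, smul_eq_mul, ← integral_mul_const]
  refine integral_congr_ae ?_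
  filter_upwards [ContinuousMap.coeFn_toLp (p := 2) (𝕜 := ℂ) volume (star ψ)] with s hs
  rw [hΨ, hs]
  simp only [sepKernel, ContinuousMap.coe_mk, RCLike.inner_apply, ContinuousMap.star_apply,
    RCLike.star_def, RCLike.conj_conj]
  ring

theorem isCompactOperator_smulRight {E F : Type*} [NormedAddCommGroup E] [NormedSpace ℂ E]
    [NormedAddCommGroup F] [NormedSpace ℂ F] (l : E →L[ℂ] ℂ) (y : F) :
    IsCompactOperator (l.smulRight y) :=
  (isCompactOperator_of_locallyCompactSpace_dom l).clm_comp
    (ContinuousLinearMap.toSpanSingleton ℂ y)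

/-- Separable kernels give operators of rank at most one, compact operators form a closed subspace,
and the operator depends continuously on its kernel. -/
theorem isCompactOperator_integralOp (k : C(I × I, ℂ)) : IsCompactOperator (integralOp k) := by
  refine map_mem_of_forall_sepKernel (partialIntegralL measurePreserving_snd)
    (W := compactOperator (RingHom.id ℂ) (L2 I) (L2 I)) isClosed_setOfPred_isCompactOperator
    (fun φ ψ => ?_) k
  change IsCompactOperator (integralOp (sepKernel φ ψ))
  rw [integralOp_sepKernel]
  exact isCompactOperator_smulRight _ _

/-- The map `((x, y), s) ↦ y` preserves Lebesgue measure. -/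
theorem measurePreserving_keepSnd : MeasurePreserving (fun z : (I × I) × I => z.1.2) :=
  (measurePreserving_snd (μ := (volume : Measure I)) (ν := (volume : Measure I))).comp
    (measurePreserving_fst (μ := (volume : Measure (I × I))) (ν := (volume : Measure I)))

/-- The operator `g ↦ φ ⊗ g`, where `(φ ⊗ g)(x, y) = φ(x) g(y)`. -/
def tensorOp (φ : C(I, ℂ)) : L2 I →L[ℂ] L2 (I × I) :=
  -- The integrand does not depend on the integration variable and `I` has measure one, so
  -- integration returns `φ(x) g(y)`.
  partialIntegralOp ⟨fun z => φ z.1.1, by fun_prop⟩ (fun z => z.1.2) measurePreserving_keepSnd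

theorem coeFn_tensorOp (φ : C(I, ℂ)) (g : L2 I) :
    tensorOp φ g =ᵐ[volume] fun p => φ p.1 * g p.2 := by
  filter_upwards [coeFn_partialIntegralOp ⟨fun z => φ z.1.1, by fun_prop⟩
    measurePreserving_keepSnd g] with p hp
  exact hp.trans (by simp)

/-- The operator `(N f)(y) = ∫₀¹ ψ(s) f(s, y) ds`. -/
def contractOp (ψ : C(I, ℂ)) : L2 (I × I) →L[ℂ] L2 I :=
  partialIntegralOp ⟨fun z => ψ z.2, by fun_prop⟩ Prod.swap Measure.measurePreserving_swap

theorem ae_snd {P : I → Prop} (h : ∀ᵐ y, P y) : ∀ᵐ p : I × I, P p.2 :=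
  (measurePreserving_snd (μ := (volume : Measure I))
    (ν := (volume : Measure I))).quasiMeasurePreserving.ae h

theorem T₁_sepKernel (φ ψ : C(I, ℂ)) :
    T₁ (sepKernel φ ψ) = tensorOp φ ∘L contractOp ψ := by
  ext1 f
  refine Lp.ext ?_
  change _ =ᵐ[volume] tensorOp φ (contractOp ψ f)
  filter_upwards [coeFn_T₁ (sepKernel φ ψ) f, coeFn_tensorOp φ (contractOp ψ f),
    ae_snd (coeFn_partialIntegralOp ⟨fun z : I × I => ψ z.2, by fun_prop⟩
      Measure.measurePreserving_swap f)] with p h1 h2 h3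
  rw [h1, h2]
  refine Eq.trans ?_ (congrArg (φ p.1 * ·) h3.symm)
  simp only [← integral_const_mul]
  refine integral_congr_ae (Filter.Eventually.of_forall fun s => ?_)
  simp only [sepKernel, ContinuousMap.coe_mk, Prod.swap_prod_mk]
  ring

theorem T₂_comp_tensorOp (k : C(I × I, ℂ)) (φ : C(I, ℂ)) :
    T₂ k ∘L tensorOp φ = tensorOp φ ∘L integralOp k := by
  ext1 g
  refine Lp.ext ?_
  change T₂ k (tensorOp φ g) =ᵐ[volume] tensorOp φ (integralOp k g)
  filter_upwards [coeFn_T₂ k (tensorOp φ g), coeFn_tensorOp φ (integralOp k g),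
    ae_snd (coeFn_integralOp k g),
    Measure.ae_ae_of_ae_prod (measurePreserving_replaceSnd.quasiMeasurePreserving.ae
      (coeFn_tensorOp φ g))] with p h1 h2 h3 h4
  rw [h1, h2, h3, ← integral_const_mul]
  refine integral_congr_ae ?_
  filter_upwards [h4] with t ht
  rw [ht]
  ring

/-- The product of a complex and a real continuous function. -/
def mulReal (φ : C(I, ℂ)) (u : C(I, ℝ)) : C(I, ℂ) := ⟨fun x => u x * φ x, by fun_prop⟩

theorem T₀_comp_tensorOp (u v : C(I, ℝ)) (φ : C(I, ℂ)) :
    T₀ u v ∘L tensorOp φ = tensorOp (mulReal φ u) +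
      tensorOp φ ∘L mulOp ⟨fun y => (v y : ℂ), by fun_prop⟩ := by
  ext1 g
  refine Lp.ext ?_
  change T₀ u v (tensorOp φ g) =ᵐ[volume]
    ↑(tensorOp (mulReal φ u) g + tensorOp φ (mulOp ⟨fun y => (v y : ℂ), by fun_prop⟩ g))
  filter_upwards [coeFn_T₀ u v (tensorOp φ g), coeFn_tensorOp φ g,
    coeFn_tensorOp (mulReal φ u) g,
    coeFn_tensorOp φ (mulOp ⟨fun y => (v y : ℂ), by fun_prop⟩ g),
    ae_snd (coeFn_mulOp ⟨fun y => (v y : ℂ), by fun_prop⟩ g),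
    Lp.coeFn_add (tensorOp (mulReal φ u) g)
      (tensorOp φ (mulOp ⟨fun y => (v y : ℂ), by fun_prop⟩ g))] with p h1 h2 h3 h4 h5 h6
  rw [h1, h2, h6, Pi.add_apply, h3, h4, h5]
  simp only [mulReal, ContinuousMap.coe_mk]
  push_cast
  ring

/-- This identity serves twice: it shows that `T₀ - T₂` preserves `tensorSpan`, and it evaluates `T`
on the trial vectors `φ ⊗ g`. -/
theorem T₀_sub_T₂_comp_tensorOp (u v : C(I, ℝ)) (k : C(I × I, ℂ)) (φ : C(I, ℂ)) :
    (T₀ u v - T₂ k) ∘L tensorOp φ =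
      tensorOp (mulReal φ u) + tensorOp φ ∘L friedrichsOp v k := by
  rw [ContinuousLinearMap.sub_comp, T₀_comp_tensorOp, T₂_comp_tensorOp, friedrichsOp,
    ContinuousLinearMap.comp_sub, add_sub_assoc]

/-- The closed span of the operators `f ↦ φ ⊗ X f`. -/
def tensorSpan : Submodule ℂ (L2 (I × I) →L[ℂ] L2 (I × I)) :=
  (Submodule.span ℂ {A | ∃ φ X, A = tensorOp φ ∘L X}).topologicalClosure

theorem tensorOp_comp_mem_tensorSpan (φ : C(I, ℂ)) (X : L2 (I × I) →L[ℂ] L2 I) :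
    tensorOp φ ∘L X ∈ tensorSpan :=
  Submodule.le_topologicalClosure _ (Submodule.subset_span ⟨φ, X, rfl⟩)

theorem comp_mem_of_mem_tensorSpan {W : Submodule ℂ (L2 (I × I) →L[ℂ] L2 (I × I))}
    (hW : IsClosed (W : Set (L2 (I × I) →L[ℂ] L2 (I × I)))) {S : L2 (I × I) →L[ℂ] L2 (I × I)}
    (h : ∀ φ X, S ∘L (tensorOp φ ∘L X) ∈ W) : ∀ A ∈ tensorSpan, S ∘L A ∈ W := by
  have hle : tensorSpan ≤ W.comap
      (ContinuousLinearMap.compL ℂ (L2 (I × I)) (L2 (I × I)) (L2 (I × I)) S).toLinearMap := by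
    refine Submodule.topologicalClosure_minimal _ (Submodule.span_le.2 ?_)
      (hW.preimage (ContinuousLinearMap.compL ℂ _ _ _ S).continuous)
    rintro _ ⟨φ, X, rfl⟩
    exact h φ X
  exact fun A hA => hle hA

theorem T₁_mem_tensorSpan (k : C(I × I, ℂ)) : T₁ k ∈ tensorSpan := by
  -- Pulling the kernel back to three variables is continuous and linear, so `k ↦ T₁ k` is too, and
  -- density reduces the claim to separable kernels.
  let Θ : C(I × I, ℂ) →L[ℂ] C((I × I) × I, ℂ) :=
    { toFun := fun k => k.comp ⟨fun z => (z.1.1, z.2), by fun_prop⟩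
      map_add' := fun _ _ => rfl
      map_smul' := fun _ _ => rfl
      cont := ContinuousMap.continuous_precomp _ }
  refine map_mem_of_forall_sepKernel ((partialIntegralL measurePreserving_replaceFst) ∘L Θ)
    (W := tensorSpan) (Submodule.isClosed_topologicalClosure _) (fun φ ψ => ?_) k
  change T₁ (sepKernel φ ψ) ∈ tensorSpan
  rw [T₁_sepKernel]
  exact tensorOp_comp_mem_tensorSpan _ _

/-- On a generator, `T₂` acts only on the second factor and there becomes the compact operator
`integralOp k`; limits of compact operators remain compact. -/
theorem isCompactOperator_T₂_comp (k : C(I × I, ℂ)) :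
    ∀ A ∈ tensorSpan, IsCompactOperator (T₂ k ∘L A) := by
  refine comp_mem_of_mem_tensorSpan
    (W := compactOperator (RingHom.id ℂ) (L2 (I × I)) (L2 (I × I)))
    isClosed_setOfPred_isCompactOperator fun φ X => ?_
  rw [← ContinuousLinearMap.comp_assoc, T₂_comp_tensorOp]
  exact ((isCompactOperator_integralOp k).clm_comp (tensorOp φ)).comp_clm X

/-- If `S = T₀ - T₂ - z` is invertible, then `T₂ S⁻¹ T₁` is compact. -/
theorem isCompactOperator_T₂_comp_inverse_comp_T₁ {u v : C(I, ℝ)} {k k₁ k₂ : C(I × I, ℂ)} {z : ℂ}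
    {R : L2 (I × I) →L[ℂ] L2 (I × I)}
    (hS : IsSelfAdjoint (T₀ u v - T₂ k - algebraMap ℂ (L2 (I × I) →L[ℂ] L2 (I × I)) z))
    (hSR : (T₀ u v - T₂ k - algebraMap ℂ _ z) * R = 1)
    (hRS : R * (T₀ u v - T₂ k - algebraMap ℂ _ z) = 1) :
    IsCompactOperator (T₂ k₂ ∘L (R ∘L T₁ k₁)) := by
  refine isCompactOperator_T₂_comp k₂ _ ?_
  refine comp_mem_of_inverse hS hSR hRS (Submodule.isClosed_topologicalClosure _) ?_ _
    (T₁_mem_tensorSpan k₁)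
  refine comp_mem_of_mem_tensorSpan (Submodule.isClosed_topologicalClosure _) fun φ X => ?_
  have h : (T₀ u v - T₂ k - algebraMap ℂ (L2 (I × I) →L[ℂ] L2 (I × I)) z) ∘L (tensorOp φ ∘L X) =
      tensorOp (mulReal φ u) ∘L X + tensorOp φ ∘L (friedrichsOp v k ∘L X)
        - z • (tensorOp φ ∘L X) := by
    rw [← ContinuousLinearMap.comp_assoc, ContinuousLinearMap.sub_comp, T₀_sub_T₂_comp_tensorOp,
      Algebra.algebraMap_eq_smul_one]
    rfl
  rw [h]
  exact Submodule.sub_mem _ (Submodule.add_mem _ (tensorOp_comp_mem_tensorSpan _ _)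
    (tensorOp_comp_mem_tensorSpan _ _)) (Submodule.smul_mem _ _ (tensorOp_comp_mem_tensorSpan _ _))

end Compactness

/-! ### Fibres over the first variable -/

section Slices

theorem eLpNorm_two_sq {Ω : Type} [MeasureSpace Ω] (f : Ω → ℂ) :
    eLpNorm f 2 volume ^ 2 = ∫⁻ x, ‖f x‖ₑ ^ (2 : ℝ) := by
  have h := eLpNorm_nnreal_pow_eq_lintegral (f := f) (p := 2) (μ := (volume : Measure Ω))
    (by norm_num)
  norm_num at h ⊢
  exact h

theorem eLpNorm_sq_eq_lintegral_slice {f : I × I → ℂ} (hf : AEStronglyMeasurable f volume) :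
    eLpNorm f 2 volume ^ 2 = ∫⁻ x, eLpNorm (fun y => f (x, y)) 2 volume ^ 2 := by
  simp only [eLpNorm_two_sq]
  exact lintegral_prod _ (hf.enorm.pow_const _)

theorem ae_memLp_slice (f : L2 (I × I)) : ∀ᵐ x, MemLp (fun y => f (x, y)) 2 volume := by
  have hm := Lp.aestronglyMeasurable f
  have h := eLpNorm_sq_eq_lintegral_slice hm
  have hfin : ∫⁻ x, eLpNorm (fun y => f (x, y)) 2 volume ^ 2 ≠ ∞ := by
    rw [← h]
    exact ENNReal.pow_ne_top (Lp.eLpNorm_ne_top f)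
  have hmeas : AEMeasurable (fun x => eLpNorm (fun y => f (x, y)) 2 volume ^ 2)
      (volume : Measure I) := by
    simp only [eLpNorm_two_sq]
    exact (hm.enorm.pow_const _).lintegral_prod_right'
  filter_upwards [ae_lt_top' hmeas hfin, hm.prodMk_left] with x h1 h2
  refine ⟨h2, ?_⟩
  by_contra h3
  rw [not_lt, top_le_iff] at h3
  simp [h3] at h1

theorem norm_tensorOp (φ : C(I, ℂ)) (g : L2 I) :
    ‖tensorOp φ g‖ = (eLpNorm φ 2 volume).toReal * ‖g‖ := by
  rw [Lp.norm_def, Lp.norm_def, ← ENNReal.toReal_mul]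
  congr 1
  have h : eLpNorm (tensorOp φ g) 2 volume ^ 2 =
      (eLpNorm φ 2 volume * eLpNorm g 2 volume) ^ 2 := by
    rw [eLpNorm_congr_ae (coeFn_tensorOp φ g), mul_pow, eLpNorm_two_sq, eLpNorm_two_sq,
      eLpNorm_two_sq]
    simp only [enorm_mul, ENNReal.mul_rpow_of_nonneg _ _ (zero_le_two : (0 : ℝ) ≤ 2)]
    exact lintegral_prod_mul (φ.continuous.aestronglyMeasurable.enorm.pow_const _)
      ((Lp.aestronglyMeasurable g).enorm.pow_const _)
  exact le_antisymm ((ENNReal.pow_le_pow_left_iff two_ne_zero).1 h.le)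
    ((ENNReal.pow_le_pow_left_iff two_ne_zero).1 h.ge)

/-- The fibres of `T₀ - T₂ - z` over the first variable. -/
theorem coeFn_fibre (u v : C(I, ℝ)) (k : C(I × I, ℂ)) (z : ℂ) (f : L2 (I × I)) :
    ∀ᵐ x, ∀ h : MemLp (fun y => f (x, y)) 2 volume,
      (friedrichsOp v k + algebraMap ℂ (L2 I →L[ℂ] L2 I) (u x - z)) (h.toLp _) =ᵐ[volume]
        fun y => (T₀ u v - T₂ k - algebraMap ℂ (L2 (I × I) →L[ℂ] L2 (I × I)) z) f (x, y) := by
  have hD : ∀ᵐ p, (T₀ u v - T₂ k - algebraMap ℂ (L2 (I × I) →L[ℂ] L2 (I × I)) z) f p =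
      ((u p.1 + v p.2 : ℝ) : ℂ) * f p - (∫ t, k (p.2, t) * f (p.1, t)) - z * f p := by
    have hDf : (T₀ u v - T₂ k - algebraMap ℂ (L2 (I × I) →L[ℂ] L2 (I × I)) z) f =
        T₀ u v f - T₂ k f - z • f := by
      rw [Algebra.algebraMap_eq_smul_one]
      rfl
    rw [hDf]
    filter_upwards [coeFn_T₀ u v f, coeFn_T₂ k f, Lp.coeFn_sub (T₀ u v f - T₂ k f) (z • f),
      Lp.coeFn_sub (T₀ u v f) (T₂ k f), Lp.coeFn_smul z f] with p h1 h2 h3 h4 h5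
    rw [h3, Pi.sub_apply, h4, Pi.sub_apply, h1, h2, h5, Pi.smul_apply, smul_eq_mul]
  filter_upwards [Measure.ae_ae_of_ae_prod hD] with x hx h
  set g : L2 I := h.toLp _ with hg
  have hS : (friedrichsOp v k + algebraMap ℂ (L2 I →L[ℂ] L2 I) (u x - z)) g =
      friedrichsOp v k g + (u x - z : ℂ) • g := by
    rw [Algebra.algebraMap_eq_smul_one]
    rfl
  rw [hS]
  filter_upwards [hx, coeFn_friedrichsOp v k g, Lp.coeFn_add (friedrichsOp v k g)
    ((u x - z : ℂ) • g), Lp.coeFn_smul (u x - z : ℂ) g, h.coeFn_toLp] with y h1 h2 h3 h4 h5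
  have h6 : ∫ t, k (y, t) * g t = ∫ t, k (y, t) * f (x, t) := by
    refine integral_congr_ae ?_
    filter_upwards [h.coeFn_toLp] with t ht
    rw [hg, ht]
  rw [h1, h3, Pi.add_apply, h2, h4, Pi.smul_apply, h6, hg, h5, smul_eq_mul]
  push_cast
  ring

/-- The fibres depend continuously on `x` in a compact space, so they share a lower bound `c`.
Integrating its square over `x` bounds the whole operator below, which suffices by self-adjointness.
-/
theorem isUnit_of_isUnit_fibre {u v : C(I, ℝ)} {k : C(I × I, ℂ)} {z : ℂ}
    (hS : IsSelfAdjoint (T₀ u v - T₂ k - algebraMap ℂ (L2 (I × I) →L[ℂ] L2 (I × I)) z))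
    (h : ∀ x, IsUnit (friedrichsOp v k + algebraMap ℂ (L2 I →L[ℂ] L2 I) (u x - z))) :
    IsUnit (T₀ u v - T₂ k - algebraMap ℂ (L2 (I × I) →L[ℂ] L2 (I × I)) z) := by
  have hcont : Continuous fun x : I =>
      friedrichsOp v k + algebraMap ℂ (L2 I →L[ℂ] L2 I) (u x - z) :=
    continuous_const.add ((continuous_algebraMap ℂ _).comp (by fun_prop))
  obtain ⟨c, hc, hbound⟩ := exists_bound_of_isUnit hcont h
  refine isUnit_of_isSelfAdjoint_of_bound hS hc fun f => ?_
  set g := (T₀ u v - T₂ k - algebraMap ℂ (L2 (I × I) →L[ℂ] L2 (I × I)) z) f with hgdef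
  have hsq : (ENNReal.ofReal c * eLpNorm f 2 volume) ^ 2 ≤ eLpNorm g 2 volume ^ 2 := by
    rw [mul_pow, eLpNorm_sq_eq_lintegral_slice (Lp.aestronglyMeasurable f),
      eLpNorm_sq_eq_lintegral_slice (Lp.aestronglyMeasurable g),
      ← lintegral_const_mul' _ _ (ENNReal.pow_ne_top ENNReal.ofReal_ne_top)]
    refine lintegral_mono_ae ?_
    filter_upwards [ae_memLp_slice f, coeFn_fibre u v k z f] with x h1 h2
    rw [← mul_pow]
    gcongr
    have h3 := hbound x (h1.toLp _)
    rw [← eLpNorm_congr_ae (h2 h1), ← eLpNorm_congr_ae h1.coeFn_toLp]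
    rw [Lp.norm_def, Lp.norm_def] at h3
    rw [← ENNReal.ofReal_toReal (Lp.eLpNorm_ne_top (h1.toLp _)), ← ENNReal.ofReal_mul hc.le]
    refine (ENNReal.ofReal_le_ofReal h3).trans ENNReal.ofReal_toReal_le
  have h1 := (ENNReal.pow_le_pow_left_iff (n := 2) (by norm_num)).1 hsq
  rw [Lp.norm_def, Lp.norm_def]
  have h2 := ENNReal.toReal_mono (Lp.eLpNorm_ne_top g) h1
  rwa [ENNReal.toReal_mul, ENNReal.toReal_ofReal hc.le] at h2

end Slices

/-! ### Trial vectors `φ ⊗ g` and the spectrum of the Schrödinger operator -/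

section ApproximateEigenvectors

/-- Ensures that a continuous bump which is non-zero at one point, possibly an endpoint, has
positive `L₂` norm. -/
theorem isOpenPosMeasure_unitInterval : (volume : Measure I).IsOpenPosMeasure := by
  refine ⟨fun U hU hne h0 => ?_⟩
  obtain ⟨V, hV, rfl⟩ := isOpen_induced_iff.1 hU
  obtain ⟨x, hx⟩ := hne
  have hcl : (x : ℝ) ∈ closure (Set.Ioo (0 : ℝ) 1) := by
    rw [closure_Ioo (by norm_num)]
    exact x.2
  have hpos : 0 < volume (V ∩ Set.Ioo (0 : ℝ) 1) :=
    (hV.inter isOpen_Ioo).measure_pos _ (mem_closure_iff.1 hcl V hV hx)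
  rw [Measure.Subtype.volume_def, comap_subtype_coe_apply measurableSet_Icc] at h0
  refine hpos.ne' (measure_mono_null ?_ h0)
  rintro y ⟨hy, hy'⟩
  exact ⟨⟨y, Set.Ioo_subset_Icc_self hy'⟩, hy, rfl⟩

/-- Continuous functions concentrated near `x₀`, whose `L₁` norm is small relative to the `L₂`
norm. -/
theorem exists_bump (u : C(I, ℝ)) (x₀ : I) {δ : ℝ} (hδ : 0 < δ) :
    ∃ φ : C(I, ℂ), 0 < (eLpNorm φ 2 volume).toReal ∧
      (∀ x, |u x - u x₀| * ‖φ x‖ ≤ δ * ‖φ x‖) ∧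
      ∫ x, ‖φ x‖ ≤ δ * (eLpNorm φ 2 volume).toReal := by
  -- A point has measure zero, so it has a neighbourhood of measure below `δ²`; Cauchy–Schwarz on
  -- the support then gives the factor `δ`.
  obtain ⟨U, hxU, hU, hUδ⟩ := Set.exists_isOpen_lt_of_lt (μ := (volume : Measure I)) {x₀}
    (ENNReal.ofReal (δ ^ 2)) (by simpa using pow_pos hδ 2)
  let V : Set I := U ∩ {x | |u x - u x₀| < δ}
  have hV : IsOpen V := hU.inter (isOpen_lt (by fun_prop) continuous_const)
  have hxV : x₀ ∈ V := ⟨hxU rfl, by simpa using hδ⟩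
  obtain ⟨χ, hχ0, hχ1, -⟩ := exists_continuous_zero_one_of_isClosed hV.isClosed_compl
    (isClosed_singleton (x := x₀)) (by simpa [Set.disjoint_singleton_right] using hxV)
  let φ : C(I, ℂ) := ⟨fun x => (χ x : ℂ), by fun_prop⟩
  have hφ : ∀ x, x ∉ V → φ x = 0 := fun x hx => by
    have : χ x = 0 := hχ0 hx
    simp [φ, this]
  have hsupp : Function.support φ ⊆ V := fun x hx => by
    by_contra h
    exact hx (hφ x h)
  have hfin : eLpNorm φ 2 volume ≠ ∞ :=
    (φ.continuous.memLp_of_hasCompactSupport (HasCompactSupport.of_compactSpace _)).eLpNorm_ne_top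
  refine ⟨φ, ?_, fun x => ?_, ?_⟩
  · refine ENNReal.toReal_pos (fun h => ?_) hfin
    have := isOpenPosMeasure_unitInterval
    rw [eLpNorm_eq_zero_iff φ.continuous.aestronglyMeasurable (by norm_num)] at h
    have h1 := (Continuous.ae_eq_iff_eq volume φ.continuous continuous_zero).1 h
    have h2 : φ x₀ = 0 := congrFun h1 x₀
    have h3 : χ x₀ = 1 := hχ1 rfl
    simp [φ, h3] at h2
  · by_cases hx : x ∈ V
    · exact mul_le_mul_of_nonneg_right (le_of_lt hx.2) (norm_nonneg _)
    · simp [hφ x hx]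
  · have h1 : eLpNorm φ 1 volume ≤ eLpNorm φ 2 volume * ENNReal.ofReal δ := by
      rw [← eLpNorm_restrict_eq_of_support_subset (p := 1) hsupp,
        ← eLpNorm_restrict_eq_of_support_subset (p := 2) hsupp]
      refine (eLpNorm_le_eLpNorm_mul_rpow_measure_univ (p := 1) (q := 2) (by norm_num)
        φ.continuous.aestronglyMeasurable).trans ?_
      gcongr
      rw [Measure.restrict_apply_univ]
      have hVδ : volume V ≤ ENNReal.ofReal (δ ^ 2) :=
        (measure_mono Set.inter_subset_left).trans hUδ.le
      refine (ENNReal.rpow_le_rpow hVδ (by norm_num)).trans_eq ?_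
      rw [ENNReal.ofReal_rpow_of_nonneg (by positivity) (by norm_num), ← Real.rpow_natCast,
        ← Real.rpow_mul hδ.le]
      norm_num
    have h2 : ∫ x, ‖φ x‖ = (eLpNorm φ 1 volume).toReal := by
      rw [eLpNorm_one_eq_lintegral_enorm,
        integral_norm_eq_lintegral_enorm φ.continuous.aestronglyMeasurable]
    rw [h2]
    refine (ENNReal.toReal_mono (ENNReal.mul_ne_top hfin ENNReal.ofReal_ne_top) h1).trans_eq ?_
    rw [ENNReal.toReal_mul, ENNReal.toReal_ofReal hδ.le, mul_comm]

theorem norm_tensorOp_one (g : L2 I) : ‖tensorOp 1 g‖ = ‖g‖ := by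
  have h : eLpNorm (1 : C(I, ℂ)) 2 (volume : Measure I) = 1 := by
    have : ((1 : C(I, ℂ)) : I → ℂ) = fun _ => 1 := rfl
    rw [this, eLpNorm_const _ (by norm_num) (NeZero.ne _)]
    simp
  rw [norm_tensorOp, h, ENNReal.toReal_one, one_mul]

/-- Only the `L₁` norm of `φ` enters, so `T₁` is negligible on a concentrated bump, whose `L₂` norm
is much larger. -/
theorem norm_T₁_tensorOp_le (k : C(I × I, ℂ)) (φ : C(I, ℂ)) (g : L2 I) :
    ‖T₁ k (tensorOp φ g)‖ ≤ ‖k‖ * (∫ x, ‖φ x‖) * ‖g‖ := by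
  rw [← norm_tensorOp_one g]
  refine Lp.norm_le_mul_norm_of_ae_le_mul ?_
  filter_upwards [coeFn_T₁ k (tensorOp φ g), coeFn_tensorOp 1 g,
    Measure.ae_ae_of_ae_prod (measurePreserving_replaceFst.quasiMeasurePreserving.ae
      (coeFn_tensorOp φ g))] with p h1 h2 h3
  have h4 : ∫ s, k (p.1, s) * (tensorOp φ g) (s, p.2) =
      (∫ s, k (p.1, s) * φ s) * g p.2 := by
    rw [← integral_mul_const]
    refine integral_congr_ae ?_
    filter_upwards [h3] with s hs
    rw [hs, mul_assoc]
  have h5 : ‖∫ s, k (p.1, s) * φ s‖ ≤ ‖k‖ * ∫ x, ‖φ x‖ := by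
    rw [← integral_const_mul]
    refine norm_integral_le_of_norm_le ?_ (Filter.Eventually.of_forall fun s => ?_)
    · exact Continuous.integrable_of_hasCompactSupport (by fun_prop)
        (HasCompactSupport.of_compactSpace _)
    · rw [norm_mul]
      exact mul_le_mul_of_nonneg_right (k.norm_coe_le_norm _) (norm_nonneg _)
  rw [h1, h4, h2, norm_mul]
  simpa using mul_le_mul_of_nonneg_right h5 (norm_nonneg (g p.2))

theorem norm_tensorOp_mulReal_sub_le {u : C(I, ℝ)} {x₀ : I} {φ : C(I, ℂ)} {δ : ℝ}
    (h : ∀ x, |u x - u x₀| * ‖φ x‖ ≤ δ * ‖φ x‖) (g : L2 I) :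
    ‖tensorOp (mulReal φ u) g - (u x₀ : ℂ) • tensorOp φ g‖ ≤ δ * ‖tensorOp φ g‖ := by
  refine Lp.norm_le_mul_norm_of_ae_le_mul ?_
  filter_upwards [coeFn_tensorOp φ g, coeFn_tensorOp (mulReal φ u) g,
    Lp.coeFn_sub (tensorOp (mulReal φ u) g) ((u x₀ : ℂ) • tensorOp φ g),
    Lp.coeFn_smul (u x₀ : ℂ) (tensorOp φ g)] with p h1 h2 h3 h4
  rw [h3, Pi.sub_apply, h2, h4, Pi.smul_apply, h1, smul_eq_mul]
  have h5 : mulReal φ u p.1 * g p.2 - u x₀ * (φ p.1 * g p.2) =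
      ((u p.1 - u x₀ : ℝ) : ℂ) * φ p.1 * g p.2 := by
    simp only [mulReal, ContinuousMap.coe_mk]
    push_cast
    ring
  rw [h5, norm_mul, norm_mul, norm_mul, Complex.norm_real, Real.norm_eq_abs, ← mul_assoc]
  exact mul_le_mul_of_nonneg_right (h p.1) (norm_nonneg _)

/-- The sum of a value of `u` and a spectral value of the one-particle operator in the second
variable is a spectral value of the Schrödinger operator. -/
theorem add_mem_spectrum (u v : C(I, ℝ)) (k₁ : C(I × I, ℂ)) {k₂ : C(I × I, ℂ)}
    (hk₂ : ∀ x s, k₂ (x, s) = star (k₂ (s, x))) (x₀ : I) {l : ℂ}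
    (hl : l ∈ spectrum ℂ (friedrichsOp v k₂)) :
    u x₀ + l ∈ spectrum ℂ (schrodingerOp u v k₁ k₂) := by
  have hH := isSelfAdjoint_friedrichsOp v hk₂
  have hlre : star l = l := by
    rw [hH.mem_spectrum_eq_re hl]
    exact Complex.conj_ofReal _
  intro hunit
  obtain ⟨c, hc, hbound⟩ := exists_bound_of_isUnit (X := Unit) continuous_const fun _ => hunit
  -- With this `δ`, the error from `T₁` and the oscillation of `u` sum to `δ(‖k₁‖ + 1) = c/3`,
  -- relative to `‖φ ⊗ g‖`. The approximate eigenvector `g` adds less than `c/3`, and the total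
  -- contradicts the lower bound `c`.
  obtain ⟨φ, hφpos, hφu, hφ1⟩ := exists_bump u x₀ (δ := c / (3 * (1 + ‖k₁‖))) (by positivity)
  obtain ⟨g, hg⟩ := exists_norm_lt_of_not_isUnit (ε := c / 3)
    ((IsSelfAdjoint.algebraMap (L2 I →L[ℂ] L2 I) hlre).sub hH) hl (by positivity)
  have hgpos : 0 < ‖g‖ := by
    by_contra h
    have := norm_nonneg ((algebraMap ℂ (L2 I →L[ℂ] L2 I) l - friedrichsOp v k₂) g)
    have h0 : ‖g‖ = 0 := le_antisymm (not_lt.1 h) (norm_nonneg g)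
    rw [h0, mul_zero] at hg
    linarith
  set F := tensorOp φ g with hF
  have hFnorm : ‖F‖ = (eLpNorm φ 2 volume).toReal * ‖g‖ := norm_tensorOp φ g
  set N := (eLpNorm φ 2 volume).toReal with hN
  have hdecomp : (algebraMap ℂ (L2 (I × I) →L[ℂ] L2 (I × I)) (u x₀ + l) -
      schrodingerOp u v k₁ k₂) F = T₁ k₁ F - (tensorOp (mulReal φ u) g - (u x₀ : ℂ) • F) +
        tensorOp φ ((algebraMap ℂ (L2 I →L[ℂ] L2 I) l - friedrichsOp v k₂) g) := by
    have h1 : (T₀ u v - T₂ k₂) F = tensorOp (mulReal φ u) g + tensorOp φ (friedrichsOp v k₂ g) :=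
      congrArg (fun A : L2 I →L[ℂ] L2 (I × I) => A g) (T₀_sub_T₂_comp_tensorOp u v k₂ φ)
    have h2 : (algebraMap ℂ (L2 (I × I) →L[ℂ] L2 (I × I)) (u x₀ + l) -
        schrodingerOp u v k₁ k₂) F = ((u x₀ : ℂ) + l) • F - ((T₀ u v - T₂ k₂) F - T₁ k₁ F) := by
      rw [Algebra.algebraMap_eq_smul_one, schrodingerOp, add_comm (T₁ k₁), ← sub_sub]
      rfl
    have h3 : (algebraMap ℂ (L2 I →L[ℂ] L2 I) l - friedrichsOp v k₂) g =
        l • g - friedrichsOp v k₂ g := by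
      rw [Algebra.algebraMap_eq_smul_one]
      rfl
    rw [h2, h1, h3, map_sub, map_smul, ← hF, add_smul]
    abel
  have h1 := hbound () F
  rw [hdecomp] at h1
  have h2 := norm_add_le (T₁ k₁ F - (tensorOp (mulReal φ u) g - (u x₀ : ℂ) • F))
    (tensorOp φ ((algebraMap ℂ (L2 I →L[ℂ] L2 I) l - friedrichsOp v k₂) g))
  have h3 := norm_sub_le (T₁ k₁ F) (tensorOp (mulReal φ u) g - (u x₀ : ℂ) • F)
  have h4 := norm_T₁_tensorOp_le k₁ φ g
  have h5 := norm_tensorOp_mulReal_sub_le hφu g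
  rw [← hF] at h4 h5
  rw [norm_tensorOp φ (_ : L2 I), ← hN] at h2
  rw [hFnorm] at h1 h5
  have h6 : N * ‖(algebraMap ℂ (L2 I →L[ℂ] L2 I) l - friedrichsOp v k₂) g‖ <
      N * (c / 3 * ‖g‖) := mul_lt_mul_of_pos_left hg hφpos
  have h7 : ‖k₁‖ * (∫ x, ‖φ x‖) * ‖g‖ ≤ ‖k₁‖ * (c / (3 * (1 + ‖k₁‖)) * N) * ‖g‖ := by gcongr
  have h8 : ‖k₁‖ * (c / (3 * (1 + ‖k₁‖)) * N) * ‖g‖ + c / (3 * (1 + ‖k₁‖)) * (N * ‖g‖) =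
      c / 3 * (N * ‖g‖) := by
    have : 1 + ‖k₁‖ ≠ 0 := by positivity
    field_simp
    ring
  have h9 : 0 < c * (N * ‖g‖) := by positivity
  nlinarith

end ApproximateEigenvectors

/-! ### Invertibility at an isolated point and finite multiplicity -/

section Isolated

/-- A singular fibre at `x` would put the whole curve `y ↦ u(y) + z - u(x)` into the spectrum. It
passes through `z` at `y = x` and is not constant, so `z` would not be isolated. -/
theorem isUnit_of_isolated {u v : C(I, ℝ)} {k₁ k₂ : C(I × I, ℂ)}
    (hk₁ : ∀ x s, k₁ (x, s) = star (k₁ (s, x))) (hk₂ : ∀ x s, k₂ (x, s) = star (k₂ (s, x)))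
    {x₀ x₁ : I} (hu : u x₁ ≠ u x₀) {z : ℂ}
    (hz : z ∈ spectrum ℂ (schrodingerOp u v k₁ k₂))
    (hiso : ∃ ε > 0, ∀ w ∈ spectrum ℂ (schrodingerOp u v k₁ k₂), dist w z < ε → w = z) :
    IsSelfAdjoint (T₀ u v - T₂ k₂ - algebraMap ℂ (L2 (I × I) →L[ℂ] L2 (I × I)) z) ∧
      IsUnit (T₀ u v - T₂ k₂ - algebraMap ℂ (L2 (I × I) →L[ℂ] L2 (I × I)) z) := by
  have hzre : star z = z := by
    rw [(isSelfAdjoint_schrodingerOp u v hk₁ hk₂).mem_spectrum_eq_re hz]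
    exact Complex.conj_ofReal _
  have hS : IsSelfAdjoint (T₀ u v - T₂ k₂ - algebraMap ℂ (L2 (I × I) →L[ℂ] L2 (I × I)) z) :=
    ((isSelfAdjoint_T₀ u v).sub (isSelfAdjoint_T₂ hk₂)).sub (IsSelfAdjoint.algebraMap _ hzre)
  refine ⟨hS, isUnit_of_isUnit_fibre hS fun x => ?_⟩
  by_contra hx
  have hmem : z - u x ∈ spectrum ℂ (friedrichsOp v k₂) := by
    intro h
    -- The spectrum is defined through `l - H`, while the fibre is `H - l` with `l = z - u(x)`;
    -- hence the change of sign.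
    refine hx ?_
    have h' := IsUnit.neg h
    convert h' using 1
    rw [← neg_sub (z : ℂ), map_neg]
    abel
  have hs : ∀ y, (u y : ℂ) + (z - u x) ∈ spectrum ℂ (schrodingerOp u v k₁ k₂) := fun y =>
    add_mem_spectrum u v k₁ hk₂ y hmem
  refine not_isolated_of_forall_mem (v := fun y => (u y : ℂ) + (z - u x)) (by fun_prop) hs
    (x₀ := x₀) (x₁ := x₁) (by simpa using hu) (y := x) ?_
  simpa using hiso

theorem isUnit_T₀_sub_T₁ {u v : C(I, ℝ)} {k : C(I × I, ℂ)} {z : ℂ}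
    (h : IsUnit (T₀ v u - T₂ k - algebraMap ℂ (L2 (I × I) →L[ℂ] L2 (I × I)) z)) :
    IsUnit (T₀ u v - T₁ k - algebraMap ℂ (L2 (I × I) →L[ℂ] L2 (I × I)) z) := by
  have heq : T₀ u v - T₁ k - algebraMap ℂ (L2 (I × I) →L[ℂ] L2 (I × I)) z =
      swapOp * (T₀ v u - T₂ k - algebraMap ℂ (L2 (I × I) →L[ℂ] L2 (I × I)) z) * swapOp := by
    rw [mul_sub, mul_sub, swapOp_T₀, swapOp_T₂, ← Algebra.commutes z swapOp, ← sub_mul, ← sub_mul,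
      mul_assoc, swapOp_mul_swapOp, mul_one]
  rw [heq]
  exact (swapUnit.isUnit.mul h).mul swapUnit.isUnit

/-- The equations `f = S⁻¹ T₁ f` and `f = S'⁻¹ T₂ f` for the elements of an eigenspace, with `S⁻¹`
and `S'⁻¹` the inverses of `T₀ - T₂ - z` and `T₀ - T₁ - z`, make it finite-dimensional. -/
theorem finiteDimensional_eigenspace {u v : C(I, ℝ)} {k₁ k₂ : C(I × I, ℂ)} {z : ℂ}
    (hS : IsSelfAdjoint (T₀ u v - T₂ k₂ - algebraMap ℂ (L2 (I × I) →L[ℂ] L2 (I × I)) z))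
    (h₂ : IsUnit (T₀ u v - T₂ k₂ - algebraMap ℂ (L2 (I × I) →L[ℂ] L2 (I × I)) z))
    (h₁ : IsUnit (T₀ u v - T₁ k₁ - algebraMap ℂ (L2 (I × I) →L[ℂ] L2 (I × I)) z)) :
    FiniteDimensional ℂ (Module.End.eigenspace
      (schrodingerOp u v k₁ k₂ : L2 (I × I) →ₗ[ℂ] L2 (I × I)) z) := by
  obtain ⟨R, hSR, hRS⟩ := isUnit_iff_exists.1 h₂
  obtain ⟨R', -, hRS'⟩ := isUnit_iff_exists.1 h₁
  have hcompact : IsCompactOperator (T₂ k₂ ∘L (R ∘L T₁ k₁)) :=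
    isCompactOperator_T₂_comp_inverse_comp_T₁ hS hSR hRS
  refine finiteDimensional_of_compact_eq_self (C := R' ∘L (T₂ k₂ ∘L (R ∘L T₁ k₁)))
    (hcompact.clm_comp R') ?_ fun f hf => ?_
  · have : (Module.End.eigenspace (schrodingerOp u v k₁ k₂ : L2 (I × I) →ₗ[ℂ] L2 (I × I)) z :
        Set (L2 (I × I))) = {f | schrodingerOp u v k₁ k₂ f = z • f} :=
      Set.ext fun f => Module.End.mem_eigenspace_iff
    rw [this]
    exact isClosed_eq (schrodingerOp u v k₁ k₂).continuous (continuous_const_smul z)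
  · have hf' : T₀ u v f - (T₁ k₁ f + T₂ k₂ f) = z • f := Module.End.mem_eigenspace_iff.1 hf
    have e₂ : (T₀ u v - T₂ k₂ - algebraMap ℂ (L2 (I × I) →L[ℂ] L2 (I × I)) z) f = T₁ k₁ f := by
      have : (T₀ u v - T₂ k₂ - algebraMap ℂ (L2 (I × I) →L[ℂ] L2 (I × I)) z) f =
          T₀ u v f - T₂ k₂ f - z • f := by
        rw [Algebra.algebraMap_eq_smul_one]
        rfl
      rw [this, ← hf']
      abel
    have e₁ : (T₀ u v - T₁ k₁ - algebraMap ℂ (L2 (I × I) →L[ℂ] L2 (I × I)) z) f = T₂ k₂ f := by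
      have : (T₀ u v - T₁ k₁ - algebraMap ℂ (L2 (I × I) →L[ℂ] L2 (I × I)) z) f =
          T₀ u v f - T₁ k₁ f - z • f := by
        rw [Algebra.algebraMap_eq_smul_one]
        rfl
      rw [this, ← hf']
      abel
    have hRf := congrArg (fun A : L2 (I × I) →L[ℂ] L2 (I × I) => A f) hRS
    have hRf' := congrArg (fun A : L2 (I × I) →L[ℂ] L2 (I × I) => A f) hRS'
    change R ((T₀ u v - T₂ k₂ - algebraMap ℂ (L2 (I × I) →L[ℂ] L2 (I × I)) z) f) = f at hRf
    change R' ((T₀ u v - T₁ k₁ - algebraMap ℂ (L2 (I × I) →L[ℂ] L2 (I × I)) z) f) = f at hRf'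
    change R' (T₂ k₂ (R (T₁ k₁ f))) = f
    rw [← e₂, hRf, ← e₁, hRf']

end Isolated

end

end FriedrichsModel

theorem mainTheorem11
    (u v : C(I, ℝ)) (k₁ k₂ : C(I × I, ℂ))
    (hu : ∀ x, 0 ≤ u x) (hv : ∀ y, 0 ≤ v y)
    (hu_zero : ∃ x, u x = 0) (hv_zero : ∃ y, v y = 0)
    (hu_ne : ∃ x, u x ≠ 0) (hv_ne : ∃ y, v y ≠ 0)
    (hk₁ : ∀ x s, k₁ (x, s) = star (k₁ (s, x)))
    (hk₂ : ∀ x s, k₂ (x, s) = star (k₂ (s, x)))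
    (hK₁ : (FriedrichsModel.integralOp k₁).IsPositive)
    (hK₂ : (FriedrichsModel.integralOp k₂).IsPositive)
    (z : ℂ) (hz : z ∈ spectrum ℂ (FriedrichsModel.schrodingerOp u v k₁ k₂))
    (hz_isolated : ∃ ε > 0, ∀ w ∈ spectrum ℂ (FriedrichsModel.schrodingerOp u v k₁ k₂),
      dist w z < ε → w = z) :
    Module.End.HasEigenvalue
        (FriedrichsModel.schrodingerOp u v k₁ k₂ :
          FriedrichsModel.L2 (I × I) →ₗ[ℂ] FriedrichsModel.L2 (I × I)) z ∧
      FiniteDimensional ℂ (Module.End.eigenspace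
        (FriedrichsModel.schrodingerOp u v k₁ k₂ :
          FriedrichsModel.L2 (I × I) →ₗ[ℂ] FriedrichsModel.L2 (I × I)) z) := by
  refine ⟨FriedrichsModel.hasEigenvalue_of_isolated
    (FriedrichsModel.isSelfAdjoint_schrodingerOp u v hk₁ hk₂) hz hz_isolated, ?_⟩
  obtain ⟨x₀, hx₀⟩ := hu_zero
  obtain ⟨x₁, hx₁⟩ := hu_ne
  obtain ⟨y₀, hy₀⟩ := hv_zero
  obtain ⟨y₁, hy₁⟩ := hv_ne
  obtain ⟨hS, h₂⟩ := FriedrichsModel.isUnit_of_isolated hk₁ hk₂ (x₀ := x₀) (x₁ := x₁)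
    (by rwa [hx₀]) hz hz_isolated
  -- The interchange of variables is a similarity, so `z` is also isolated for the operator with `u,
  -- v` and `k₁, k₂` exchanged.
  have hswap := FriedrichsModel.spectrum_schrodingerOp_swap u v k₁ k₂
  have h₁ := FriedrichsModel.isUnit_T₀_sub_T₁
    (FriedrichsModel.isUnit_of_isolated hk₂ hk₁ (u := v) (v := u) (x₀ := y₀) (x₁ := y₁)
      (by rwa [hy₀]) (hswap ▸ hz) (hswap ▸ hz_isolated)).2
  exact FriedrichsModel.finiteDimensional_eigenspace hS h₂ h₁
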